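/- Let $N=\{1,\dots,n\}$ with $n\ge 1$ be a set of agents and let $M=\{g_1,\dots,g_m\}$ with $m\ge 0$ be a set of indivisible goods. Each agent $i$ has an additive valuation function $v_i:2^M\to\mathbb{R}$, i.e. $v_i(\{g\})\ge 0$ for every $g\in M$ and $v_i(S\cup T)=v_i(S)+v_i(T)$ for all disjoint $S,T\subseteq M$; ties between goods and goods of value zero are allowed. The Round-Robin mechanism takes as input a bid profile $\mathbf{b}=(b_1,\dots,b_n)$ of bid vectors $b_i\in\mathbb{R}_{\ge 0}^{m}$ and runs $\lceil m/n\rceil$ rounds. In each round the agents $1,2,\dots,n$ take turns in this order, and, in her turn, agent $i$ receives the still unallocated good with the highest bid according to $b_i$, where ties are broken in favor of the good of lowest index (she receives nothing if all the goods have been allocated). Let $A_i(\mathbf{b})$ be the set of goods that agent $i$ has received in the end. A bid profile $\mathbf{b}$ is a pure Nash equilibrium if for every agent $i$ and every bid vector $b_i'\in\mathbb{R}_{\ge 0}^{m}$ we have $v_i(A_i(b_i',\mathbf{b}_{-i}))\le v_i(A_i(\mathbf{b}))$, where $(b_i',\mathbf{b}_{-i})$ denotes $\mathbf{b}$ with $b_i$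 replaced by $b_i'$. **Theorem.** For every such instance $(N,M,(v_1,\dots,v_n))$, the Round-Robin mechanism has at least one pure Nash equilibrium. -/

import Mathlib

open scoped NNReal

namespace FairDivision

/-- A valuation function over the goods `Fin m` : every single good has a non-negative value,
and the value of a union of two disjoint sets of goods is the sum of their values.
Ties between goods and goods of value zero are allowed. -/
structure AdditiveValuation (m : ℕ) where
  val : Finset (Fin m) → ℝ
  nonneg : ∀ g : Fin m, 0 ≤ val {g}
  additive : ∀ S T : Finset (Fin m), Disjoint S T → val (S ∪ T) = val S + val T

/-- An allocation of all the goods `Fin m` to the agents `Fin n`: the (possibly empty) bundles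
are pairwise disjoint and together contain every good. -/
structure Allocation (n m : ℕ) where
  bundle : Fin n → Finset (Fin m)
  disjoint : ∀ i j : Fin n, i ≠ j → Disjoint (bundle i) (bundle j)
  cover : ∀ g : Fin m, ∃ i : Fin n, g ∈ bundle i

/-- A bid vector declares a non-negative value for every good. -/
abbrev Bid (m : ℕ) : Type := Fin m → ℝ≥0

/-- A bid profile has one bid vector for each agent. -/
abbrev BidProfile (n m : ℕ) : Type := Fin n → Bid m

/-- An allocation mechanism (without payments) maps bid profiles to allocations. -/
abbrev Mechanism (n m : ℕ) : Type := BidProfile n m → Allocation n m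

/-- `b i` is a best response of agent `i`, with true valuation `vi`, to the bids of the others:
no unilateral change of the bid of `i` gives her a bundle of higher true value. -/
def IsBestResponse {n m : ℕ} (mech : Mechanism n m) (vi : AdditiveValuation m)
    (b : BidProfile n m) (i : Fin n) : Prop :=
  ∀ b' : Bid m, vi.val ((mech (Function.update b i b')).bundle i) ≤ vi.val ((mech b).bundle i)

/-- `b` is a pure Nash equilibrium of the mechanism with respect to the true valuations `v`. -/
def IsPNE {n m : ℕ} (mech : Mechanism n m) (v : Fin n → AdditiveValuation m)
    (b : BidProfile n m) : Prop :=
  ∀ i : Fin n, IsBestResponse mech (v i) b i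

namespace RoundRobin

/-- The available goods of highest bid. -/
noncomputable def maximizers {m : ℕ} (bi : Bid m) (S : Finset (Fin m)) : Finset (Fin m) :=
  S.filter (fun g => ∀ h ∈ S, bi h ≤ bi g)

theorem maximizers_nonempty {m : ℕ} (bi : Bid m) (S : Finset (Fin m)) (hS : S.Nonempty) :
    (maximizers bi S).Nonempty := by
  obtain ⟨g, hg, hmax⟩ := S.exists_max_image bi hS
  exact ⟨g, Finset.mem_filter.mpr ⟨hg, hmax⟩⟩

/-- The available good of highest bid; among several ones, the one of lowest index. -/
noncomputable def favorite {m : ℕ} (bi : Bid m) (S : Finset (Fin m)) (hS : S.Nonempty) : Fin m :=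
  (maximizers bi S).min' (maximizers_nonempty bi S hS)

theorem favorite_mem {m : ℕ} (bi : Bid m) (S : Finset (Fin m)) (hS : S.Nonempty) :
    favorite bi S hS ∈ S :=
  (Finset.mem_filter.mp ((maximizers bi S).min'_mem (maximizers_nonempty bi S hS))).1

/-- The set of available goods, and the bundles assigned so far. -/
structure State (n m : ℕ) where
  avail : Finset (Fin m)
  bundle : Fin n → Finset (Fin m)

/-- At the start all the goods are available and all the bundles are empty. -/
def init (n m : ℕ) : State n m := ⟨Finset.univ, fun _ => ∅⟩

/-- The turn of agent `i`: she receives her favorite available good according to her bid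
(nothing happens if no good is left, as in the last turns of an incomplete last round). -/
noncomputable def turn {n m : ℕ} (b : BidProfile n m) (s : State n m) (i : Fin n) : State n m :=
  if hS : s.avail.Nonempty then
    { avail := s.avail.erase (favorite (b i) s.avail hS)
      bundle := Function.update s.bundle i (insert (favorite (b i) s.avail hS) (s.bundle i)) }
  else s

/-- One round: the agents take their turns in the order `0, 1, …, n - 1`. -/
noncomputable def round {n m : ℕ} (b : BidProfile n m) (s : State n m) : State n m :=
  (List.finRange n).foldl (turn b) s

/-- The state after `⌈m / n⌉` rounds. -/
noncomputable def final {n m : ℕ} (b : BidProfile n m) : State n m :=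
  (round b)^[⌈(m : ℚ) / (n : ℚ)⌉₊] (init n m)

/-- The goods are partitioned into the available ones and the bundles. -/
def Consistent {n m : ℕ} (s : State n m) : Prop :=
  (∀ i j : Fin n, i ≠ j → Disjoint (s.bundle i) (s.bundle j)) ∧
  (∀ i : Fin n, Disjoint s.avail (s.bundle i)) ∧
  (∀ g : Fin m, g ∈ s.avail ∨ ∃ i : Fin n, g ∈ s.bundle i)

theorem turn_consistent {n m : ℕ} (b : BidProfile n m) (s : State n m) (i : Fin n)
    (hs : Consistent s) : Consistent (turn b s i) := by
  unfold turn
  split_ifs with hS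
  · obtain ⟨h1, h2, h3⟩ := hs
    have hf := favorite_mem (b i) s.avail hS
    generalize favorite (b i) s.avail hS = f at hf
    have hfn : ∀ j, f ∉ s.bundle j := fun j => Finset.disjoint_left.mp (h2 j) hf
    refine ⟨?_, ?_, ?_⟩
    · intro j k hjk
      by_cases hj : j = i
      · subst hj
        simp [Function.update_of_ne hjk.symm, Finset.disjoint_insert_left, hfn, h1 _ _ hjk]
      · by_cases hk : k = i
        · subst hk
          simp [Function.update_of_ne hj, Finset.disjoint_insert_right, hfn, h1 _ _ hjk]
        · simp [Function.update_of_ne hj, Function.update_of_ne hk, h1 _ _ hjk]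
    · intro j
      by_cases hj : j = i
      · subst hj
        simp only [Function.update_self, Finset.disjoint_insert_right]
        exact ⟨by simp, (h2 _).mono_left (Finset.erase_subset _ _)⟩
      · simp only [Function.update_of_ne hj]
        exact (h2 _).mono_left (Finset.erase_subset _ _)
    · intro g
      by_cases hg : g = f
      · exact Or.inr ⟨i, by simp [hg]⟩
      · rcases h3 g with h | ⟨j, h⟩
        · exact Or.inl (Finset.mem_erase.mpr ⟨hg, h⟩)
        · refine Or.inr ⟨j, ?_⟩
          by_cases hj : j = i
          · subst hj
            simp [h]
          · simpa [Function.update_of_ne hj] using h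
  · exact hs

theorem turn_card {n m : ℕ} (b : BidProfile n m) (s : State n m) (i : Fin n) :
    (turn b s i).avail.card = s.avail.card - 1 := by
  unfold turn
  split_ifs with hS
  · exact Finset.card_erase_of_mem (favorite_mem (b i) s.avail hS)
  · simp [Finset.not_nonempty_iff_eq_empty.mp hS]

theorem foldl_turn {n m : ℕ} (b : BidProfile n m) (l : List (Fin n)) (s : State n m)
    (hs : Consistent s) : Consistent (l.foldl (turn b) s) ∧
      (l.foldl (turn b) s).avail.card = s.avail.card - l.length := by
  induction l generalizing s with
  | nil => exact ⟨hs, by simp⟩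
  | cons i l ih =>
    obtain ⟨h1, h2⟩ := ih (turn b s i) (turn_consistent b s i hs)
    refine ⟨h1, ?_⟩
    rw [List.foldl_cons, h2, turn_card, List.length_cons]
    omega

theorem iterate_round {n m : ℕ} (b : BidProfile n m) (k : ℕ) (s : State n m)
    (hs : Consistent s) : Consistent ((round b)^[k] s) ∧
      ((round b)^[k] s).avail.card = s.avail.card - k * n := by
  induction k generalizing s with
  | zero => exact ⟨hs, by simp⟩
  | succ k ih =>
    obtain ⟨h1, h2⟩ := foldl_turn b (List.finRange n) s hs
    obtain ⟨h3, h4⟩ := ih (round b s) h1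
    refine ⟨h3, ?_⟩
    rw [Function.iterate_succ_apply, h4, round, h2, List.length_finRange, Nat.succ_mul]
    omega

theorem final_consistent {n m : ℕ} (b : BidProfile n m) : Consistent (final b) :=
  (iterate_round b _ (init n m) ⟨by simp [init], by simp [init], by simp [init]⟩).1

theorem final_avail {n m : ℕ} (hn : 0 < n) (b : BidProfile n m) : (final b).avail = ∅ := by
  have h := (iterate_round b ⌈(m : ℚ) / (n : ℚ)⌉₊ (init n m)
    ⟨by simp [init], by simp [init], by simp [init]⟩).2
  have hk : m ≤ ⌈(m : ℚ) / (n : ℚ)⌉₊ * n := by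
    have h0 : (0 : ℚ) < n := by exact_mod_cast hn
    have h1 := (div_le_iff₀ h0).mp (Nat.le_ceil ((m : ℚ) / (n : ℚ)))
    exact_mod_cast h1
  rw [← Finset.card_eq_zero, final, h]
  simp only [init, Finset.card_univ, Fintype.card_fin]
  omega

end RoundRobin

/-- The Round-Robin mechanism for `n ≥ 1` agents. -/
noncomputable def roundRobin {n m : ℕ} (hn : 0 < n) : Mechanism n m := fun b =>
  { bundle := (RoundRobin.final b).bundle
    disjoint := (RoundRobin.final_consistent b).1
    cover := fun g => by
      rcases (RoundRobin.final_consistent b).2.2 g with h | h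
      · rw [RoundRobin.final_avail hn b] at h
        exact absurd h (Finset.notMem_empty g)
      · exact h }

end FairDivision

namespace FairDivision

/-! Let the agents pick truthfully in turn; this orders the goods so that the agent with turn `t`
values the good at position `t` at least as much as every later one (`exists_greedy_perm`). The
equilibrium is the profile in which everyone bids this common order, so the goods are given out in
it (`runTurns_rankBid`). If only agent `i` deviates, the others still take the earliest available
good. Hence for every `p` she ends with at most as many of the first `p` goods as she has turns
before `p` (`runTurns_deviation`). Her new positions, sorted, are therefore no earlier than her
turns, term by term, and greediness at her turns gives the inequality of values
(`sum_le_sum_of_card_filter_lt_le`). -/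

theorem AdditiveValuation.val_eq_sum {m : ℕ} (v : AdditiveValuation m) (S : Finset (Fin m)) :
    v.val S = ∑ g ∈ S, v.val {g} := by
  induction S using Finset.induction_on with
  | empty =>
    have h := v.additive ∅ ∅ (by simp)
    simp only [Finset.empty_union] at h
    simp only [Finset.sum_empty]
    linarith
  | insert g S hg ih =>
    rw [Finset.sum_insert hg, ← ih, Finset.insert_eq, v.additive]
    simpa using hg

/-! ### Greedy orders and comparison of sums -/

/-- If position `t` is served according to the weights `w t`, a greedy order of the goods exists. -/
theorem exists_greedy_perm {m : ℕ} (w : Fin m → Fin m → ℝ) :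
    ∃ σ : Equiv.Perm (Fin m), ∀ t p : Fin m, t ≤ p → w t (σ p) ≤ w t (σ t) := by
  suffices h : ∀ k : ℕ, k ≤ m → ∃ σ : Equiv.Perm (Fin m),
      ∀ t p : Fin m, (t : ℕ) < k → t ≤ p → w t (σ p) ≤ w t (σ t) by
    obtain ⟨σ, hσ⟩ := h m le_rfl
    exact ⟨σ, fun t p => hσ t p t.isLt⟩
  intro k
  induction k with
  | zero => exact fun _ => ⟨1, fun t p h => absurd h (Nat.not_lt_zero _)⟩
  | succ k ih =>
    intro hk
    obtain ⟨σ, hσ⟩ := ih (by omega)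
    -- Swapping the best remaining good into position `k` fixes the earlier positions and permutes
    -- the later ones among themselves, so greediness obtained so far survives.
    let q : Fin m := ⟨k, hk⟩
    obtain ⟨r, hr, hmax⟩ := (Finset.Ici q).exists_max_image (fun p => w q (σ p)) ⟨q, by simp⟩
    rw [Finset.mem_Ici] at hr
    have hge : ∀ t p : Fin m, t ≤ q → t ≤ p → t ≤ Equiv.swap q r p := by
      intro t p htq htp
      rw [Equiv.swap_apply_def]
      split_ifs
      · exact htq.trans hr
      · exact htq
      · exact htp
    refine ⟨(Equiv.swap q r).trans σ, fun t p ht htp => ?_⟩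
    simp only [Equiv.trans_apply]
    rcases Nat.lt_succ_iff_lt_or_eq.mp ht with htk | htk
    · have htq : t < q := htk
      rw [Equiv.swap_apply_of_ne_of_ne (a := q) (b := r) (x := t) htq.ne (htq.trans_le hr).ne]
      exact hσ t _ htk (hge t p htq.le htp)
    · obtain rfl : t = q := Fin.ext htk
      rw [Equiv.swap_apply_left]
      exact hmax _ (Finset.mem_Ici.mpr (hge _ p le_rfl htp))

/-- If `X` lies pointwise to the right of `T` and `w t` bounds all the weights to the right
of `t` for `t ∈ T`, then `T` has at least the total weight of `X`. -/
theorem sum_le_sum_of_card_filter_lt_le {α : Type*} [LinearOrder α] (w : α → ℝ)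
    (X T : Finset α) (hcard : X.card = T.card)
    (hcount : ∀ p, (X.filter (· < p)).card ≤ (T.filter (· < p)).card)
    (hw : ∀ t ∈ T, ∀ p, t ≤ p → w p ≤ w t) :
    ∑ x ∈ X, w x ≤ ∑ t ∈ T, w t := by
  induction hk : X.card generalizing X T with
  | zero =>
    have hX : X = ∅ := Finset.card_eq_zero.mp hk
    have hT : T = ∅ := Finset.card_eq_zero.mp (hcard ▸ hk)
    simp [hX, hT]
  | succ k ih =>
    have hX : X.Nonempty := Finset.card_pos.mp (by omega)
    have hT : T.Nonempty := Finset.card_pos.mp (by omega)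
    have hxX := X.min'_mem hX
    have htT := T.min'_mem hT
    have hxmin : ∀ y ∈ X, X.min' hX ≤ y := fun y hy => X.min'_le y hy
    have htmin : ∀ y ∈ T, T.min' hT ≤ y := fun y hy => T.min'_le y hy
    generalize X.min' hX = x at hxX hxmin
    generalize T.min' hT = t at htT htmin
    -- Nothing in `T` lies below its minimum `t`, so the count at `p = t` allows nothing of `X`
    -- there. The two minima can thus be matched and removed.
    have htx : t ≤ x := by
      by_contra! hlt
      have h0 : T.filter (· < t) = ∅ :=
        Finset.filter_eq_empty_iff.mpr fun y hy => (htmin y hy).not_gt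
      have h1 := hcount t
      rw [h0, Finset.card_empty, Nat.le_zero, Finset.card_eq_zero] at h1
      exact Finset.notMem_empty x (h1 ▸ Finset.mem_filter.mpr ⟨hxX, hlt⟩)
    rw [← Finset.add_sum_erase X w hxX, ← Finset.add_sum_erase T w htT]
    refine add_le_add (hw t htT x htx) (ih _ _ ?_ ?_ ?_ ?_)
    · rw [Finset.card_erase_of_mem hxX, Finset.card_erase_of_mem htT, hcard]
    · intro p
      rw [Finset.filter_erase, Finset.filter_erase]
      by_cases hp : x < p
      · have hx : x ∈ X.filter (· < p) := Finset.mem_filter.mpr ⟨hxX, hp⟩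
        have ht : t ∈ T.filter (· < p) := Finset.mem_filter.mpr ⟨htT, htx.trans_lt hp⟩
        rw [Finset.card_erase_of_mem hx, Finset.card_erase_of_mem ht]
        exact Nat.sub_le_sub_right (hcount p) 1
      · have h0 : X.filter (· < p) = ∅ :=
          Finset.filter_eq_empty_iff.mpr fun y hy hy' => hp ((hxmin y hy).trans_lt hy')
        simp [h0]
    · exact fun s hs => hw s (Finset.mem_of_mem_erase hs)
    · rw [Finset.card_erase_of_mem hxX, hk, Nat.add_sub_cancel]

namespace RoundRobin

/-! ### Rounds flattened into single turns -/

/-- The state after `t` single turns, where agent `a u` has turn number `u`. -/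
noncomputable def runTurns {n m : ℕ} (b : BidProfile n m) (a : ℕ → Fin n) : ℕ → State n m
  | 0 => init n m
  | t + 1 => turn b (runTurns b a t) (a t)

theorem runTurns_consistent {n m : ℕ} (b : BidProfile n m) (a : ℕ → Fin n) (t : ℕ) :
    Consistent (runTurns b a t) := by
  induction t with
  | zero => exact ⟨by simp [runTurns, init], by simp [runTurns, init], by simp [runTurns, init]⟩
  | succ t ih => exact turn_consistent b _ _ ih

theorem runTurns_card {n m : ℕ} (b : BidProfile n m) (a : ℕ → Fin n) (t : ℕ) :
    (runTurns b a t).avail.card = m - t := by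
  induction t with
  | zero => simp [runTurns, init]
  | succ t ih =>
    rw [runTurns, turn_card, ih]
    omega

theorem runTurns_nonempty {n m : ℕ} (b : BidProfile n m) (a : ℕ → Fin n) {t : ℕ} (ht : t < m) :
    (runTurns b a t).avail.Nonempty := by
  rw [← Finset.card_pos, runTurns_card]
  omega

theorem runTurns_of_le {n m : ℕ} (b : BidProfile n m) (a : ℕ → Fin n) {t : ℕ} (ht : m ≤ t) :
    runTurns b a t = runTurns b a m := by
  induction t, ht using Nat.le_induction with
  | base => rfl
  | succ t ht ih =>
    have hempty : ¬ (runTurns b a t).avail.Nonempty := by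
      rw [← Finset.card_pos, runTurns_card]
      omega
    rw [runTurns, turn, dif_neg hempty, ih]

/-- The agents in the order of their turns. -/
def agentAt {n : ℕ} (hn : 0 < n) (t : ℕ) : Fin n := ⟨t % n, Nat.mod_lt t hn⟩

theorem round_runTurns {n m : ℕ} (hn : 0 < n) (b : BidProfile n m) (k : ℕ) :
    round b (runTurns b (agentAt hn) (k * n)) = runTurns b (agentAt hn) ((k + 1) * n) := by
  have h : ∀ j ≤ n, ((List.finRange n).take j).foldl (turn b) (runTurns b (agentAt hn) (k * n)) =
      runTurns b (agentAt hn) (k * n + j) := by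
    intro j
    induction j with
    | zero => simp
    | succ j ih =>
      intro hj
      have hlt : j < (List.finRange n).length := by simpa using hj
      rw [List.take_succ_eq_append_getElem hlt, List.foldl_append, ih (by omega), ← Nat.add_assoc,
        runTurns]
      have hagent : agentAt hn (k * n + j) = ⟨j, hj⟩ :=
        Fin.ext (by simp [agentAt, Nat.mod_eq_of_lt (Nat.lt_of_succ_le hj)])
      simp [hagent]
  have h' := h n le_rfl
  rwa [List.take_of_length_le (by simp), ← Nat.succ_mul] at h'

/-- The `⌈m / n⌉ * n ≥ m` turns beyond the first `m` find no good left and change nothing. -/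
theorem final_eq_runTurns {n m : ℕ} (hn : 0 < n) (b : BidProfile n m) :
    final b = runTurns b (agentAt hn) m := by
  have h : ∀ k, (round b)^[k] (init n m) = runTurns b (agentAt hn) (k * n) := by
    intro k
    induction k with
    | zero => simp [runTurns]
    | succ k ih => rw [Function.iterate_succ_apply', ih, round_runTurns]
  rw [final, h]
  refine runTurns_of_le b _ ?_
  have h0 : (0 : ℚ) < n := by exact_mod_cast hn
  have h1 := (div_le_iff₀ h0).mp (Nat.le_ceil ((m : ℚ) / (n : ℚ)))
  exact_mod_cast h1

/-! ### The common ranking and a single deviator -/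

/-- The bid vector that ranks the goods as `σ 0, σ 1, …`. -/
def rankBid {m : ℕ} (σ : Equiv.Perm (Fin m)) : Bid m := fun g => ((m - (σ.symm g : ℕ) : ℕ) : ℝ≥0)

/-- Positions are below `m`, so the bids `m - position` decrease strictly and the tie-breaking rule
plays no role. -/
theorem symm_favorite_rankBid_le {m : ℕ} (σ : Equiv.Perm (Fin m)) (S : Finset (Fin m))
    (hS : S.Nonempty) {g : Fin m} (hg : g ∈ S) :
    σ.symm (favorite (rankBid σ) S hS) ≤ σ.symm g := by
  have h := (Finset.mem_filter.mp
    ((maximizers (rankBid σ) S).min'_mem (maximizers_nonempty _ S hS))).2 g hg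
  change rankBid σ g ≤ rankBid σ (favorite (rankBid σ) S hS) at h
  simp only [rankBid, Nat.cast_le] at h
  have h1 := (σ.symm g).isLt
  rw [Fin.le_def]
  omega

/-- If all the agents bid according to `σ`, then the goods are allocated in this order. -/
theorem runTurns_rankBid {n m : ℕ} (σ : Equiv.Perm (Fin m)) (a : ℕ → Fin n) (t : ℕ) (ht : t ≤ m) :
    (∀ g, g ∈ (runTurns (fun _ => rankBid σ) a t).avail ↔ t ≤ (σ.symm g : ℕ)) ∧
    ∀ i g, g ∈ (runTurns (fun _ => rankBid σ) a t).bundle i ↔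
      (σ.symm g : ℕ) < t ∧ a (σ.symm g) = i := by
  induction t with
  | zero => simp [runTurns, init]
  | succ t ih =>
    obtain ⟨h1, h2⟩ := ih (by omega)
    have hS := runTurns_nonempty (fun _ => rankBid σ) a (Nat.lt_of_succ_le ht)
    have hf : favorite (rankBid σ) _ hS = σ ⟨t, ht⟩ := by
      rw [← Equiv.symm_apply_eq]
      refine le_antisymm ?_ ((h1 _).mp (favorite_mem _ _ hS))
      have h := symm_favorite_rankBid_le σ _ hS ((h1 (σ ⟨t, ht⟩)).mpr (by simp))
      simpa using h
    have hne : ∀ g, g = σ ⟨t, ht⟩ ↔ (σ.symm g : ℕ) = t := fun g => by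
      rw [← Equiv.symm_apply_eq, Fin.ext_iff]
    rw [runTurns, turn, dif_pos hS, hf]
    dsimp only
    refine ⟨fun g => ?_, fun i g => ?_⟩
    · rw [Finset.mem_erase, h1, Ne, hne]
      omega
    · by_cases hi : i = a t
      · subst hi
        rw [Function.update_self, Finset.mem_insert, h2, hne]
        constructor
        · rintro (h | ⟨h, h'⟩)
          · exact ⟨by omega, by rw [h]⟩
          · exact ⟨by omega, h'⟩
        · rintro ⟨h, h'⟩
          rcases Nat.lt_succ_iff_lt_or_eq.mp h with h | h
          · exact Or.inr ⟨h, h'⟩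
          · exact Or.inl h
      · rw [Function.update_of_ne hi, h2]
        constructor
        · exact fun ⟨h, h'⟩ => ⟨by omega, h'⟩
        · rintro ⟨h, h'⟩
          rcases Nat.lt_succ_iff_lt_or_eq.mp h with h | h
          · exact ⟨h, h'⟩
          · exact absurd (h ▸ h').symm hi

theorem card_filter_symm_lt_le {m : ℕ} (σ : Equiv.Perm (Fin m)) (p : ℕ) :
    (Finset.univ.filter fun g : Fin m => (σ.symm g : ℕ) < p).card ≤ p := by
  rw [← Finset.card_range p]
  refine Finset.card_le_card_of_injOn (fun g => (σ.symm g : ℕ)) (fun g hg => by simpa using hg) ?_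
  exact fun g _ h _ hgh => σ.symm.injective (Fin.ext hgh)

/-- If all the agents other than `i` bid according to `σ`, then they hold goods that precede all
the available ones, and agent `i` holds no more of the first `p` goods than if she bid
according to `σ` as well. -/
theorem runTurns_deviation {n m : ℕ} (σ : Equiv.Perm (Fin m)) (a : ℕ → Fin n) (i : Fin n)
    (b : BidProfile n m) (hb : ∀ j, j ≠ i → b j = rankBid σ) (t : ℕ) (ht : t ≤ m) :
    (∀ j, j ≠ i → ∀ g ∈ (runTurns b a t).bundle j, ∀ h ∈ (runTurns b a t).avail,
      σ.symm g < σ.symm h) ∧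
    ((runTurns b a t).bundle i).card = Nat.count (fun u => a u = i) t ∧
    ∀ p : ℕ, (((runTurns b a t).bundle i).filter fun g => (σ.symm g : ℕ) < p).card ≤
      Nat.count (fun u => a u = i) (min p t) := by
  induction t with
  | zero => simp [runTurns, init]
  | succ t ih =>
    obtain ⟨h1, h2, h3⟩ := ih (by omega)
    have hS := runTurns_nonempty b a (Nat.lt_of_succ_le ht)
    have hcons := runTurns_consistent b a t
    have hcard := runTurns_card b a t
    rw [runTurns, turn, dif_pos hS]
    dsimp only
    generalize runTurns b a t = s at *
    have hf := favorite_mem (b (a t)) s.avail hS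
    have hfb : ∀ j, favorite (b (a t)) s.avail hS ∉ s.bundle j :=
      fun j => Finset.disjoint_left.mp (hcons.2.1 j) hf
    by_cases hi : a t = i
    · rw [hi] at hf hfb ⊢
      generalize favorite (b i) s.avail hS = f at *
      refine ⟨?_, ?_, ?_⟩
      · intro j hj g hg h hh
        rw [Function.update_of_ne hj] at hg
        exact h1 j hj g hg h (Finset.mem_of_mem_erase hh)
      · rw [Function.update_self, Finset.card_insert_of_notMem (hfb i), h2, Nat.count_succ,
          if_pos hi]
      · intro p
        rw [Function.update_self]
        rcases le_or_gt p (σ.symm f : ℕ) with hp | hp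
        · rw [Finset.filter_insert, if_neg (by omega)]
          exact (h3 p).trans (Nat.count_monotone _ (by omega))
        rcases lt_or_ge t p with htp | htp
        · rw [Finset.filter_insert, if_pos hp, min_eq_right (by omega), Nat.count_succ, if_pos hi]
          refine (Finset.card_insert_le _ _).trans ?_
          have := h3 p
          rw [min_eq_right htp.le] at this
          omega
        · rw [min_eq_left (by omega)]
          -- The crucial case: `f` is among the first `p` goods although turn `p` has come. Since
          -- `f` was still available, all goods held by the others precede it, so they too are among
          -- the first `p`.
          have hsub : ((insert f (s.bundle i)).filter fun g => (σ.symm g : ℕ) < p) ∪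
              (s.avail ∪ s.bundle i)ᶜ ⊆ Finset.univ.filter fun g => (σ.symm g : ℕ) < p := by
            intro g hg
            rw [Finset.mem_filter]
            refine ⟨Finset.mem_univ g, ?_⟩
            rcases Finset.mem_union.mp hg with hg | hg
            · exact (Finset.mem_filter.mp hg).2
            · simp only [Finset.mem_compl, Finset.mem_union, not_or] at hg
              obtain ⟨j, hj⟩ := (hcons.2.2 g).resolve_left hg.1
              have hji : j ≠ i := fun h => hg.2 (h ▸ hj)
              have := Fin.lt_def.mp (h1 j hji g hj f hf)
              omega
          have hdisj : Disjoint ((insert f (s.bundle i)).filter fun g => (σ.symm g : ℕ) < p)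
              (s.avail ∪ s.bundle i)ᶜ := by
            refine Finset.disjoint_left.mpr fun g hg hg' => ?_
            simp only [Finset.mem_compl, Finset.mem_union, not_or] at hg'
            rcases Finset.mem_insert.mp (Finset.mem_filter.mp hg).1 with h | h
            · exact hg'.1 (h ▸ hf)
            · exact hg'.2 h
          have hle := (Finset.card_le_card hsub).trans (card_filter_symm_lt_le σ p)
          rw [Finset.card_union_of_disjoint hdisj, Finset.card_compl, Fintype.card_fin,
            Finset.card_union_of_disjoint (hcons.2.1 i), hcard, h2] at hle
          -- The others hold `t - count t` goods, which leaves agent `i` at most `p - (t - count t)`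
          -- of the first `p`. This is at most `count p`, as she has at most `t - p` turns from `p`
          -- up to `t`.
          obtain ⟨d, rfl⟩ := Nat.exists_eq_add_of_le htp
          rw [Nat.count_add] at hle
          have := Nat.count_le (p := fun k => a (p + k) = i) (n := d)
          omega
    -- Another agent takes the earliest available good, which precedes all that remain.
    · have hbi : b (a t) = rankBid σ := hb _ hi
      have hmin := fun g (hg : g ∈ s.avail) => symm_favorite_rankBid_le σ s.avail hS hg
      rw [hbi] at hf hfb ⊢
      generalize favorite (rankBid σ) s.avail hS = f at *
      simp only [Function.update_of_ne (Ne.symm hi)]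
      refine ⟨?_, ?_, ?_⟩
      · intro j hj g hg h hh
        have hh' := Finset.mem_erase.mp hh
        by_cases hja : j = a t
        · subst hja
          rw [Function.update_self, Finset.mem_insert] at hg
          rcases hg with rfl | hg
          · exact lt_of_le_of_ne (hmin h hh'.2) fun he => hh'.1 (σ.symm.injective he).symm
          · exact h1 _ hj g hg h hh'.2
        · rw [Function.update_of_ne hja] at hg
          exact h1 j hj g hg h hh'.2
      · rw [h2, Nat.count_succ, if_neg hi, Nat.add_zero]
      · exact fun p => (h3 p).trans (Nat.count_monotone _ (by omega))

theorem card_filter_lt_eq_count {m : ℕ} (P : ℕ → Prop) [DecidablePred P] {p : ℕ} (hp : p ≤ m) :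
    (Finset.univ.filter fun t : Fin m => P t ∧ (t : ℕ) < p).card = Nat.count P p := by
  rw [Nat.count_eq_card_filter_range, ← Finset.card_map Fin.valEmbedding]
  congr 1
  ext u
  simp only [Finset.mem_map, Finset.mem_filter, Finset.mem_univ, true_and, Finset.mem_range,
    Fin.valEmbedding_apply]
  constructor
  · rintro ⟨t, ⟨h, h'⟩, rfl⟩
    exact ⟨h', h⟩
  · exact fun ⟨h, h'⟩ => ⟨⟨u, by omega⟩, ⟨h', h⟩, rfl⟩

end RoundRobin

end FairDivision

/-! ### The equilibrium -/

open FairDivision RoundRobin in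
theorem theoremA3 (n m : ℕ) (hn : 0 < n) (v : Fin n → FairDivision.AdditiveValuation m) :
    ∃ b : FairDivision.BidProfile n m,
      FairDivision.IsPNE (FairDivision.roundRobin hn) v b := by
  obtain ⟨σ, hσ⟩ := exists_greedy_perm fun t g : Fin m => (v (agentAt hn t)).val {g}
  refine ⟨fun _ => rankBid σ, fun i b' => ?_⟩
  change (v i).val ((final _).bundle i) ≤ (v i).val ((final _).bundle i)
  rw [final_eq_runTurns hn, final_eq_runTurns hn]
  obtain ⟨-, hcard, hcount⟩ := runTurns_deviation σ (agentAt hn) i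
    (Function.update (fun _ => rankBid σ) i b') (fun j hj => Function.update_of_ne hj _ _) m le_rfl
  generalize (runTurns (Function.update (fun _ => rankBid σ) i b') (agentAt hn) m).bundle i = X
    at hcard hcount ⊢
  have hT : (runTurns (fun _ => rankBid σ) (agentAt hn) m).bundle i =
      (Finset.univ.filter fun t : Fin m => agentAt hn t = i).map σ.toEmbedding := by
    ext g
    rw [(runTurns_rankBid σ (agentAt hn) m le_rfl).2, Finset.mem_map_equiv]
    simp
  -- Both bundles become images of sets of positions under `σ`, where the comparison of sums
  -- applies.
  have hX : X = (X.map σ.symm.toEmbedding).map σ.toEmbedding := by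
    ext g
    simp [Finset.mem_map_equiv]
  rw [hT, hX, AdditiveValuation.val_eq_sum, Finset.sum_map _ σ.toEmbedding,
    AdditiveValuation.val_eq_sum, Finset.sum_map _ σ.toEmbedding]
  refine sum_le_sum_of_card_filter_lt_le (fun t => (v i).val {σ t}) _ _ ?_ ?_ ?_
  · rw [Finset.card_map, hcard, ← card_filter_lt_eq_count _ le_rfl]
    simp
  · intro p
    have h := hcount p
    rw [min_eq_left p.isLt.le, ← card_filter_lt_eq_count _ p.isLt.le] at h
    rw [Finset.filter_map, Finset.card_map, Finset.filter_filter]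
    exact h
  · intro t ht p hp
    -- Greediness at `t` concerns the agent whose turn it is, and for `t` in this set that agent is
    -- `i`.
    obtain rfl := (Finset.mem_filter.mp ht).2
    exact hσ t p hp
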